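/- For an integer $t\ge 0$ let $P_5^{t}$ denote the caterpillar obtained from a path of length $4$ (that is, on $5$ vertices) by attaching $t$ pendant edges to each of its three internal vertices. A finite simple graph $G$ is called $H$-saturated if $G$ contains no copy of $H$ as a (not necessarily induced) subgraph, but adding to $G$ any edge between two distinct nonadjacent vertices creates a copy of $H$; let $\operatorname{sat}(n,H)$ be the minimum number of edges of an $H$-saturated graph with $n$ vertices. Theorem. For any integer $s\ge 1$ and any integer $n \ge q(2s+4)+s+1$, where $q=\max\{2,\lfloor (s-1)/2\rfloor\}$, $$\left(s+\frac{2}{s+3}\right)\frac n2-c_1\;\le\;\operatorname{sat}(n,P_5^{s-1})\;\le\;\left(s+\frac{2}{s+2}\right)\frac n2+c_2,$$ where $c_1=\dfrac{2s+3}{2s+6}+\dfrac{(s+1)^2}{8}$ and $c_2=\dfrac{s(s+1)}{s+2}$. -/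

import Mathlib

namespace SaturationNumber

open SimpleGraph

/-- `G` is `H`-saturated: it contains no copy of `H` (as a not necessarily induced subgraph), but
adding any new edge between two distinct nonadjacent vertices creates one. -/
def IsSaturated {W V : Type*} (H : SimpleGraph W) (G : SimpleGraph V) : Prop :=
  H.Free G ∧ ∀ x y : V, x ≠ y → ¬ G.Adj x y → ¬ H.Free (G ⊔ SimpleGraph.edge x y)

/-- The saturation number `sat(n, H)`: the minimum number of edges of an `H`-saturated graph of
order `n`. The minimum is over a nonempty set whenever `H` has an edge, see `exists_isSaturated`. -/
noncomputable def sat {W : Type*} (n : ℕ) (H : SimpleGraph W) : ℕ :=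
  sInf {m : ℕ | ∃ G : SimpleGraph (Fin n), IsSaturated H G ∧ G.edgeSet.ncard = m}

theorem exists_isSaturated {W V : Type*} [Finite V] (H : SimpleGraph W) (hH : H ≠ ⊥) :
    ∃ G : SimpleGraph V, IsSaturated H G := by
  obtain ⟨G, hG⟩ := (Set.toFinite {G : SimpleGraph V | H.Free G}).exists_maximal
    ⟨⊥, free_bot hH⟩
  refine ⟨G, hG.prop, fun x y hxy hadj hfree => hadj ?_⟩
  have hle : G ⊔ SimpleGraph.edge x y ≤ G := hG.le_of_ge hfree le_sup_left
  exact hle (Or.inr (by simp [SimpleGraph.edge_adj, hxy]))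

/-- The caterpillar `P₅ᵗ`: a path `0 - 1 - 2 - 3 - 4` of length `4` (the vertices `Sum.inl i`),
with `t` pendant edges attached to each of the three internal vertices `1, 2, 3` of the path: the
leaves `Sum.inr (k, a)`, for `a : Fin t`, are adjacent exactly to the path vertex `k + 1`. -/
def caterpillar (t : ℕ) : SimpleGraph (Fin 5 ⊕ Fin 3 × Fin t) where
  Adj
    | .inl i, .inl j => (pathGraph 5).Adj i j
    | .inl i, .inr (k, _) => i.val = k.val + 1
    | .inr (k, _), .inl i => i.val = k.val + 1
    | .inr _, .inr _ => False
  symm := ⟨by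
    rintro (i | ⟨k, a⟩) (j | ⟨l, b⟩) h
    · exact SimpleGraph.Adj.symm h
    · exact h
    · exact h
    · exact h⟩
  loopless := ⟨by
    rintro (i | ⟨k, a⟩) h
    · exact (pathGraph 5).irrefl h
    · exact h⟩

end SaturationNumber

/-!
Write `s = t + 1`. A copy of `P₅ᵗ` is a path `a b c` with enough private neighbours, so its internal
vertices have degree at least `t + 2`. If a new edge `xy` completes a copy, then one of its ends has
degree at least `t + 1` and a neighbour of degree at least `t + 2` (a big vertex), subject to a
further restriction when both bounds are attained.

Lower bound. The vertices of degree at most `t + 1` that cannot play this role form a clique with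
`m` vertices, so their degrees fall short of `t + 1` by at most `m (t + 2 - m) ≤ (t + 2)² / 4` in
total. All other vertices of degree at most `t + 1` have degree exactly `t + 1` and a big neighbour;
let each of them give weight `1` to every big neighbour, or `2` if there is only one. With an error
of `1` for a single big vertex, a big vertex `b` receives at most `(t + 4) (deg b - (t + 1)) - 2`.
The critical case is `deg b = t + 2`, where at most one neighbour gives weight `2` to `b`. Hence the
total surplus of the degrees over `t + 1` is at least about `2 n / (t + 4)`.

Upper bound. Take pairs of adjacent centers with at least `t + 2` leaves each, every leaf being
joined to `t` leaves of centers that are neither its own nor matched with it, and possibly a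
disjoint clique on `t + 2` vertices and a few pendant vertices. Two adjacent centers with their
leaves lack only a third internal vertex to form `P₅ᵗ`, so any further edge between vertices that
are not pendant creates a copy, and in every `P₅ᵗ`-free supergraph the pendant vertices have degree
at most `t + 1`. It is therefore enough to bound the edges of an arbitrary saturated supergraph.
-/

namespace SaturationNumber

open SimpleGraph Finset

/-! ### Copies of caterpillars -/

/-- The vertices `a`, `b`, `c` form a path in `G` and have enough private neighbours, in `A`, `B`
and `C` respectively, to be the spine of a copy of `caterpillar t`. -/
structure IsCaterpillar {V : Type*} (G : SimpleGraph V) (t : ℕ) (a b c : V)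
    (A B C : Finset V) : Prop where
  adj_ab : G.Adj a b
  adj_bc : G.Adj b c
  ne_ac : a ≠ c
  adjA : ∀ v ∈ A, G.Adj a v ∧ v ≠ b ∧ v ≠ c
  adjB : ∀ v ∈ B, G.Adj b v ∧ v ≠ a ∧ v ≠ c
  adjC : ∀ v ∈ C, G.Adj c v ∧ v ≠ a ∧ v ≠ b
  le_cardA : t + 1 ≤ #A
  le_cardB : t ≤ #B
  le_cardC : t + 1 ≤ #C
  disjAB : Disjoint A B
  disjAC : Disjoint A C
  disjBC : Disjoint B C

section Caterpillar

variable {V : Type*} {G G' : SimpleGraph V} {t : ℕ} {a b c : V} {A B C : Finset V}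

theorem exists_embedding_of_le_card {n : ℕ} {S : Finset V} (h : n ≤ #S) :
    ∃ f : Fin n ↪ V, ∀ i, f i ∈ S := by
  obtain ⟨f⟩ := Function.Embedding.nonempty_of_card_le (α := Fin n) (β := S) (by simpa using h)
  exact ⟨f.trans (Function.Embedding.subtype _), fun i => (f i).2⟩

namespace IsCaterpillar

theorem reverse (h : IsCaterpillar G t a b c A B C) : IsCaterpillar G t c b a C B A where
  adj_ab := h.adj_bc.symm
  adj_bc := h.adj_ab.symm
  ne_ac := h.ne_ac.symm
  adjA v hv := ⟨(h.adjC v hv).1, (h.adjC v hv).2.symm⟩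
  adjB v hv := ⟨(h.adjB v hv).1, (h.adjB v hv).2.symm⟩
  adjC v hv := ⟨(h.adjA v hv).1, (h.adjA v hv).2.symm⟩
  le_cardA := h.le_cardC
  le_cardB := h.le_cardB
  le_cardC := h.le_cardA
  disjAB := h.disjBC.symm
  disjAC := h.disjAC.symm
  disjBC := h.disjAB.symm

theorem of_adj (h : IsCaterpillar G t a b c A B C)
    (ha : ∀ v, G.Adj a v → G'.Adj a v) (hb : ∀ v, G.Adj b v → G'.Adj b v)
    (hc : ∀ v, G.Adj c v → G'.Adj c v) : IsCaterpillar G' t a b c A B C :=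
  { h with
    adj_ab := ha _ h.adj_ab
    adj_bc := hb _ h.adj_bc
    adjA := fun v hv => ⟨ha _ (h.adjA v hv).1, (h.adjA v hv).2⟩
    adjB := fun v hv => ⟨hb _ (h.adjB v hv).1, (h.adjB v hv).2⟩
    adjC := fun v hv => ⟨hc _ (h.adjC v hv).1, (h.adjC v hv).2⟩ }

theorem not_free (h : IsCaterpillar G t a b c A B C) : ¬ (caterpillar t).Free G := by
  obtain ⟨f, hf⟩ := exists_embedding_of_le_card h.le_cardA
  obtain ⟨g, hg⟩ := exists_embedding_of_le_card h.le_cardB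
  obtain ⟨k, hk⟩ := exists_embedding_of_le_card h.le_cardC
  let φ : Fin 5 ⊕ Fin 3 × Fin t → V
    | .inl i => ![f (Fin.last t), a, b, c, k (Fin.last t)] i
    | .inr (i, j) => ![f j.castSucc, g j, k j.castSucc] i
  have hφ : Function.Injective φ := by
    have hAB := Finset.disjoint_left.mp h.disjAB
    have hAC := Finset.disjoint_left.mp h.disjAC
    have hBC := Finset.disjoint_left.mp h.disjBC
    have ne_ab := h.adj_ab.ne
    have ne_bc := h.adj_bc.ne
    have ne_ac := h.ne_ac
    have hA : ∀ v ∈ A, v ≠ a ∧ v ≠ b ∧ v ≠ c := fun v hv =>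
      ⟨(h.adjA v hv).1.ne', (h.adjA v hv).2⟩
    have hB : ∀ v ∈ B, v ≠ a ∧ v ≠ b ∧ v ≠ c := fun v hv =>
      ⟨(h.adjB v hv).2.1, (h.adjB v hv).1.ne', (h.adjB v hv).2.2⟩
    have hC : ∀ v ∈ C, v ≠ a ∧ v ≠ b ∧ v ≠ c := fun v hv =>
      ⟨(h.adjC v hv).2.1, (h.adjC v hv).2.2, (h.adjC v hv).1.ne'⟩
    have := f.injective
    have := g.injective
    have := k.injective
    have hlast := fun j : Fin t => j.castSucc_ne_last
    rintro (i | ⟨i, p⟩) (j | ⟨j, q⟩) hij <;> fin_cases i <;> fin_cases j <;>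
      simp [φ] at hij ⊢ <;> grind
  have hadj : ∀ x y, (caterpillar t).Adj x y → G.Adj (φ x) (φ y) := by
    have hA := fun i => (h.adjA _ (hf i)).1
    have hB := fun i => (h.adjB _ (hg i)).1
    have hC := fun i => (h.adjC _ (hk i)).1
    have hab := h.adj_ab
    have hbc := h.adj_bc
    rintro (i | ⟨i, p⟩) (j | ⟨j, q⟩) hij <;> fin_cases i <;> fin_cases j <;>
      simp [caterpillar, pathGraph_adj] at hij <;> simp [φ, hA, hB, hC, hab, hbc, G.adj_comm]
  exact fun hfree => hfree ⟨⟨⟨φ, hadj _ _⟩, hφ⟩⟩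

theorem map {W : Type*} {H : SimpleGraph W} (h : IsCaterpillar G t a b c A B C) (f : Copy G H) :
    IsCaterpillar H t (f a) (f b) (f c) (A.map f.toEmbedding) (B.map f.toEmbedding)
      (C.map f.toEmbedding) where
  adj_ab := f.toHom.map_adj h.adj_ab
  adj_bc := f.toHom.map_adj h.adj_bc
  ne_ac := f.injective.ne h.ne_ac
  adjA := Finset.forall_mem_map.2 fun v hv =>
    ⟨f.toHom.map_adj (h.adjA v hv).1, f.injective.ne (h.adjA v hv).2.1,
      f.injective.ne (h.adjA v hv).2.2⟩
  adjB := Finset.forall_mem_map.2 fun v hv =>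
    ⟨f.toHom.map_adj (h.adjB v hv).1, f.injective.ne (h.adjB v hv).2.1,
      f.injective.ne (h.adjB v hv).2.2⟩
  adjC := Finset.forall_mem_map.2 fun v hv =>
    ⟨f.toHom.map_adj (h.adjC v hv).1, f.injective.ne (h.adjC v hv).2.1,
      f.injective.ne (h.adjC v hv).2.2⟩
  le_cardA := (A.card_map _).symm ▸ h.le_cardA
  le_cardB := (B.card_map _).symm ▸ h.le_cardB
  le_cardC := (C.card_map _).symm ▸ h.le_cardC
  disjAB := (Finset.disjoint_map _).2 h.disjAB
  disjAC := (Finset.disjoint_map _).2 h.disjAC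
  disjBC := (Finset.disjoint_map _).2 h.disjBC

end IsCaterpillar

theorem exists_isCaterpillar_caterpillar (t : ℕ) :
    ∃ A B C, IsCaterpillar (caterpillar t) t (.inl 1) (.inl 2) (.inl 3) A B C := by
  classical
  let leaves (k : Fin 3) : Finset (Fin 5 ⊕ Fin 3 × Fin t) := univ.image fun j => .inr (k, j)
  have card_leaves (k) : #(leaves k) = t := by
    rw [card_image_of_injective _ fun i j h => by simpa using h, card_fin]
  refine ⟨insert (.inl 0) (leaves 0), leaves 1, insert (.inl 4) (leaves 2), ?_⟩
  have hA : Sum.inl 0 ∉ leaves 0 := by simp [leaves]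
  have hC : Sum.inl 4 ∉ leaves 2 := by simp [leaves]
  constructor <;> first
    | simp [hA, hC, card_leaves]; done
    | simp [leaves, caterpillar, pathGraph_adj, Finset.disjoint_left]

theorem exists_isCaterpillar_of_not_free (h : ¬ (caterpillar t).Free G) :
    ∃ a b c A B C, IsCaterpillar G t a b c A B C := by
  obtain ⟨f⟩ : (caterpillar t).IsContained G := not_not.mp h
  obtain ⟨A, B, C, hABC⟩ := exists_isCaterpillar_caterpillar t
  exact ⟨_, _, _, _, _, _, hABC.map f⟩

end Caterpillar

section SpineEdge

variable {V : Type*} [Fintype V] {G : SimpleGraph V} [DecidableRel G.Adj] {t : ℕ}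
  {a b c p q u v : V} {A B C : Finset V}

/-- The conditions that the degrees of two consecutive internal vertices of a copy of
`caterpillar t` satisfy: each is at least `t + 2`, and if both are equal to it then all neighbours
are used by the copy, so that there is no common one. -/
structure IsSpineEdge (G : SimpleGraph V) [DecidableRel G.Adj] (t : ℕ) (u v : V) : Prop where
  adj : G.Adj u v
  le_degree_left : t + 2 ≤ G.degree u
  le_degree_right : t + 2 ≤ G.degree v
  not_adj : G.degree u = t + 2 → G.degree v = t + 2 → ∀ w, G.Adj u w → ¬ G.Adj v w

theorem IsSpineEdge.symm (h : IsSpineEdge G t u v) : IsSpineEdge G t v u where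
  adj := h.adj.symm
  le_degree_left := h.le_degree_right
  le_degree_right := h.le_degree_left
  not_adj hv hu w hvw huw := h.not_adj hu hv w huw hvw

namespace IsCaterpillar

theorem isSpineEdge_left (h : IsCaterpillar G t a b c A B C) : IsSpineEdge G t a b := by
  classical
  have ha : insert b A ⊆ G.neighborFinset a := by
    simpa [insert_subset_iff, h.adj_ab, subset_iff] using fun v hv => (h.adjA v hv).1
  have hb : insert a (insert c B) ⊆ G.neighborFinset b := by
    simpa [insert_subset_iff, h.adj_ab.symm, h.adj_bc, subset_iff]
      using fun v hv => (h.adjB v hv).1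
  have card_a : t + 2 ≤ #(insert b A) := by
    rw [card_insert_of_notMem fun hA => (h.adjA b hA).2.1 rfl]
    exact Nat.succ_le_succ h.le_cardA
  have card_b : t + 2 ≤ #(insert a (insert c B)) := by
    rw [card_insert_of_notMem, card_insert_of_notMem]
    · exact Nat.add_le_add_right h.le_cardB 2
    · exact fun hB => (h.adjB c hB).2.2 rfl
    · simpa [h.ne_ac] using fun hB => (h.adjB a hB).2.1 rfl
  refine ⟨h.adj_ab, card_a.trans (card_le_card ha), card_b.trans (card_le_card hb),
    fun da db w haw hbw => ?_⟩
  have hwa : w ∈ insert b A :=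
    eq_of_subset_of_card_le ha (da.trans_le card_a) ▸ (G.mem_neighborFinset a w).2 haw
  have hwb : w ∈ insert a (insert c B) :=
    eq_of_subset_of_card_le hb (db.trans_le card_b) ▸ (G.mem_neighborFinset b w).2 hbw
  have hwA : w ∈ A := (mem_insert.1 hwa).resolve_left hbw.ne'
  have hwB : w ∈ insert c B := (mem_insert.1 hwb).resolve_left haw.ne'
  exact Finset.disjoint_left.1 h.disjAB hwA
    ((mem_insert.1 hwB).resolve_left (h.adjA w hwA).2.2)

theorem isSpineEdge_right (h : IsCaterpillar G t a b c A B C) : IsSpineEdge G t b c :=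
  h.reverse.isSpineEdge_left.symm

theorem exists_isSpineEdge (h : IsCaterpillar G t a b c A B C) (hp : p = a ∨ p = b ∨ p = c)
    (q : V) : (∃ z ≠ q, IsSpineEdge G t p z) ∨ ∃ z ≠ p, IsSpineEdge G t q z := by
  have hab := h.isSpineEdge_left
  have hbc := h.isSpineEdge_right
  by_cases hq : q = b
  · subst hq
    rcases hp with rfl | rfl | rfl
    · exact .inr ⟨c, h.ne_ac.symm, hbc⟩
    · exact .inl ⟨a, hab.adj.ne, hab.symm⟩
    · exact .inr ⟨a, h.ne_ac, hab.symm⟩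
  · rcases hp with rfl | rfl | rfl
    · exact .inl ⟨b, Ne.symm hq, hab⟩
    · by_cases hqa : q = a
      · exact .inl ⟨c, hqa ▸ h.ne_ac.symm, hbc⟩
      · exact .inl ⟨a, Ne.symm hqa, hab.symm⟩
    · exact .inl ⟨b, Ne.symm hq, hbc.symm⟩

end IsCaterpillar

theorem exists_isSpineEdge_of_not_free (h : ¬ (caterpillar t).Free G) :
    ∃ u v w, u ≠ w ∧ IsSpineEdge G t u v ∧ IsSpineEdge G t v w := by
  obtain ⟨a, b, c, A, B, C, hABC⟩ := exists_isCaterpillar_of_not_free h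
  exact ⟨a, b, c, hABC.ne_ac, hABC.isSpineEdge_left, hABC.isSpineEdge_right⟩

end SpineEdge

/-! ### Degrees in saturated graphs -/

section SupEdge

variable {V : Type*} {G : SimpleGraph V} {x y : V}

theorem sup_edge_adj_left (hxy : x ≠ y) {v : V} :
    (G ⊔ edge x y).Adj x v ↔ v = y ∨ G.Adj x v := by
  simp only [sup_adj, edge_adj]
  grind

theorem sup_edge_adj_of_ne {u : V} (hx : u ≠ x) (hy : u ≠ y) {v : V} :
    (G ⊔ edge x y).Adj u v ↔ G.Adj u v := by
  simp only [sup_adj, edge_adj]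
  grind

end SupEdge

section Activation

variable {V : Type*} [Fintype V] {G : SimpleGraph V} [DecidableRel G.Adj] {t : ℕ} {x y : V}

/-- `Activates G t x y`: the trace in `G` of a copy of `caterpillar t` in `G + xy` that has `x` as
an internal vertex, next to an internal vertex `z ≠ y`. -/
def Activates (G : SimpleGraph V) [DecidableRel G.Adj] (t : ℕ) (x y : V) : Prop :=
  t + 1 ≤ G.degree x ∧ ∃ z, G.Adj x z ∧ t + 1 < G.degree z ∧
    (G.degree x = t + 1 → G.degree z = t + 2 → ∀ v, v = y ∨ G.Adj x v → ¬ G.Adj z v)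

theorem degree_sup_edge_left [DecidableEq V] (hxy : x ≠ y) (hadj : ¬ G.Adj x y) :
    (G ⊔ edge x y).degree x = G.degree x + 1 := by
  have h : (G ⊔ edge x y).neighborFinset x = insert y (G.neighborFinset x) := by
    ext v
    simp only [mem_neighborFinset, sup_edge_adj_left hxy, mem_insert]
  rw [← card_neighborFinset_eq_degree, h, card_insert_of_notMem (by simpa using hadj),
    card_neighborFinset_eq_degree]

theorem degree_sup_edge_of_ne [DecidableEq V] {u : V} (hx : u ≠ x) (hy : u ≠ y) :
    (G ⊔ edge x y).degree u = G.degree u := by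
  simp only [← card_neighborFinset_eq_degree]
  congr 1
  ext v
  simp only [mem_neighborFinset, sup_edge_adj_of_ne hx hy]

theorem IsSpineEdge.activates [DecidableEq V] {z : V} (hxy : x ≠ y) (hadj : ¬ G.Adj x y)
    (hz : z ≠ y) (h : IsSpineEdge (G ⊔ edge x y) t x z) : Activates G t x y := by
  have deg_x := degree_sup_edge_left hxy hadj
  have deg_z := degree_sup_edge_of_ne (G := G) h.adj.ne' hz
  have hxz : G.Adj x z := ((sup_edge_adj_left hxy).1 h.adj).resolve_left hz
  refine ⟨by have := h.le_degree_left; omega, z, hxz, by have := h.le_degree_right; omega,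
    fun hx hz' v hv hzv => ?_⟩
  exact h.not_adj (by omega) (by omega) v ((sup_edge_adj_left hxy).2 hv)
    ((sup_edge_adj_of_ne h.adj.ne' hz).2 hzv)

theorem IsCaterpillar.activates {a b c : V} {A B C : Finset V} (hxy : x ≠ y)
    (hadj : ¬ G.Adj x y) (h : IsCaterpillar (G ⊔ edge x y) t a b c A B C)
    (hx : x = a ∨ x = b ∨ x = c) : Activates G t x y ∨ Activates G t y x := by
  classical
  refine (h.exists_isSpineEdge hx y).imp ?_ ?_
  · rintro ⟨z, hz, hxz⟩
    exact hxz.activates hxy hadj hz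
  · rintro ⟨z, hz, hyz⟩
    have hyz' : IsSpineEdge (G ⊔ edge y x) t y z := by
      convert hyz using 1
      rw [edge_comm]
    exact hyz'.activates hxy.symm (mt G.adj_symm hadj) hz

theorem IsSaturated.activates (hG : IsSaturated (caterpillar t) G) (hxy : x ≠ y)
    (hadj : ¬ G.Adj x y) : Activates G t x y ∨ Activates G t y x := by
  obtain ⟨a, b, c, A, B, C, h⟩ := exists_isCaterpillar_of_not_free (hG.2 x y hxy hadj)
  by_cases hx : x = a ∨ x = b ∨ x = c
  · exact h.activates hxy hadj hx
  by_cases hy : y = a ∨ y = b ∨ y = c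
  · rw [edge_comm] at h
    exact (h.activates hxy.symm (mt G.adj_symm hadj) hy).symm
  have transfer {u : V} (hu : u = a ∨ u = b ∨ u = c) (v : V) (huv : (G ⊔ edge x y).Adj u v) :
      G.Adj u v :=
    (sup_edge_adj_of_ne (by rintro rfl; exact hx hu) (by rintro rfl; exact hy hu)).1 huv
  have hG' := h.of_adj (transfer (.inl rfl)) (transfer (.inr (.inl rfl)))
    (transfer (.inr (.inr rfl)))
  exact (hG'.not_free hG.1).elim

end Activation

section LowerBound

variable {V : Type*} [Fintype V] (G : SimpleGraph V) [DecidableRel G.Adj] (t : ℕ)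

/-- The vertices whose degree exceeds `t + 1`. -/
def big : Finset V := {x | t + 1 < G.degree x}

open Classical in
/-- The vertices of degree `t + 1` that activate some other vertex. They have a big neighbour. -/
noncomputable def mobile : Finset V := {x | G.degree x = t + 1 ∧ ∃ y, Activates G t x y}

open Classical in
/-- The vertices of degree at most `t + 1` that activate no vertex. In a saturated graph they form
a clique. -/
noncomputable def inert : Finset V := {x | G.degree x ≤ t + 1 ∧ ∀ y, ¬ Activates G t x y}

/-- The mobile neighbours of `b`. -/
noncomputable def mobileAt (b : V) : Finset V := {x ∈ mobile G t | G.Adj b x}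

open Classical in
/-- The mobile vertices whose only big neighbour is `b`. -/
noncomputable def exclusive (b : V) : Finset V :=
  {x ∈ mobile G t | ∀ z ∈ big G t, G.Adj x z ↔ z = b}

variable {G t} {x y b : V}

theorem mem_big : x ∈ big G t ↔ t + 1 < G.degree x := by simp [big]

theorem mem_mobile : x ∈ mobile G t ↔ G.degree x = t + 1 ∧ ∃ y, Activates G t x y := by
  simp [mobile]

theorem mem_inert : x ∈ inert G t ↔ G.degree x ≤ t + 1 ∧ ∀ y, ¬ Activates G t x y := by
  simp [inert]

theorem mem_mobileAt : x ∈ mobileAt G t b ↔ x ∈ mobile G t ∧ G.Adj b x := by simp [mobileAt]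

theorem mem_exclusive :
    x ∈ exclusive G t b ↔ x ∈ mobile G t ∧ ∀ z ∈ big G t, G.Adj x z ↔ z = b := by
  simp [exclusive]

theorem Activates.exists_mem_big_adj (h : Activates G t x y) : ∃ z ∈ big G t, G.Adj x z := by
  obtain ⟨-, z, hxz, hz, -⟩ := h
  exact ⟨z, mem_big.2 hz, hxz⟩

theorem card_big_add_card_mobile_add_card_inert :
    #(big G t) + #(mobile G t) + #(inert G t) = Fintype.card V := by
  classical
  have hbm : Disjoint (big G t) (mobile G t) := by
    rw [Finset.disjoint_left]
    intro x hx hx'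
    exact (mem_big.1 hx).ne' (mem_mobile.1 hx').1
  have hi : Disjoint (big G t ∪ mobile G t) (inert G t) := by
    rw [Finset.disjoint_left]
    intro x hx hx'
    rcases mem_union.1 hx with hb | hm
    · exact (mem_big.1 hb).not_ge (mem_inert.1 hx').1
    · exact (mem_mobile.1 hm).2.elim (mem_inert.1 hx').2
  rw [← card_union_of_disjoint hbm, ← card_union_of_disjoint hi,
    ← card_univ]
  congr 1
  refine eq_univ_of_forall fun x => ?_
  simp only [mem_union, mem_big, mem_mobile, mem_inert]
  by_cases hx : ∃ y, Activates G t x y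
  · have := hx.choose_spec.1
    grind
  · grind

theorem two_mul_card_mobile_le :
    2 * #(mobile G t) ≤ ∑ b ∈ big G t, (#(mobileAt G t b) + #(exclusive G t b)) := by
  classical
  have hM : ∑ b ∈ big G t, #(mobileAt G t b) = ∑ x ∈ mobile G t, #{b ∈ big G t | G.Adj b x} :=
    sum_card_bipartiteAbove_eq_sum_card_bipartiteBelow _
  have hE : ∑ b ∈ big G t, #(exclusive G t b) =
      ∑ x ∈ mobile G t, #{b ∈ big G t | ∀ z ∈ big G t, G.Adj x z ↔ z = b} :=
    sum_card_bipartiteAbove_eq_sum_card_bipartiteBelow _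
  rw [sum_add_distrib, hM, hE, ← sum_add_distrib, mul_comm, ← smul_eq_mul,
    ← sum_const]
  refine sum_le_sum fun x hx => ?_
  obtain ⟨y, hy⟩ := (mem_mobile.1 hx).2
  obtain ⟨z, hz, hxz⟩ := hy.exists_mem_big_adj
  have hz' : z ∈ {b ∈ big G t | G.Adj b x} := mem_filter.2 ⟨hz, hxz.symm⟩
  by_cases hu : ∀ w ∈ big G t, G.Adj x w ↔ w = z
  · exact Nat.add_le_add (card_pos.2 ⟨z, hz'⟩)
      (card_pos.2 ⟨z, mem_filter.2 ⟨hz, hu⟩⟩)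
  · obtain ⟨w, hw, hxw, hwz⟩ : ∃ w ∈ big G t, G.Adj x w ∧ w ≠ z := by grind
    exact Nat.le_add_right_of_le (one_lt_card.2
      ⟨w, mem_filter.2 ⟨hw, hxw.symm⟩, z, hz', hwz⟩)

theorem card_mobileAt_le : #(mobileAt G t b) ≤ G.degree b :=
  card_le_card fun x hx => (G.mem_neighborFinset b x).2 (mem_mobileAt.1 hx).2

theorem card_mobileAt_lt {z : V} (hz : z ∈ big G t) (hbz : G.Adj b z) :
    #(mobileAt G t b) < G.degree b :=
  card_lt_card <| ssubset_iff_of_subset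
    (fun x hx => (G.mem_neighborFinset b x).2 (mem_mobileAt.1 hx).2) |>.2
    ⟨z, (G.mem_neighborFinset b z).2 hbz, fun hzm =>
      (mem_big.1 hz).ne' (mem_mobile.1 (mem_mobileAt.1 hzm).1).1⟩

theorem card_exclusive_le_card_mobileAt (hb : b ∈ big G t) :
    #(exclusive G t b) ≤ #(mobileAt G t b) :=
  card_le_card fun _ hx =>
    have hx' := mem_exclusive.1 hx
    mem_mobileAt.2 ⟨hx'.1, ((hx'.2 b hb).2 rfl).symm⟩

theorem not_activates_of_exclusive (hb : G.degree b = t + 2) (hx : x ∈ exclusive G t b)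
    (hby : G.Adj b y) : ¬ Activates G t x y := by
  rintro ⟨-, z, hxz, hz, hnadj⟩
  have hx' := mem_exclusive.1 hx
  obtain rfl : z = b := (hx'.2 z (mem_big.2 hz)).1 hxz
  exact hnadj (mem_mobile.1 hx'.1).1 hb y (.inl rfl) hby

namespace IsSaturated

variable (hG : IsSaturated (caterpillar t) G)

include hG

theorem eq_of_forall_big_not_adj (hx : ∀ z ∈ big G t, ¬ G.Adj x z) (hy : ∀ z ∈ big G t, ¬ G.Adj y z)
    (hyb : y ∈ big G t) : x = y := by
  by_contra hne
  rcases hG.activates hne (hx y hyb) with h | h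
  · obtain ⟨z, hz, hxz⟩ := h.exists_mem_big_adj
    exact hx z hz hxz
  · obtain ⟨z, hz, hyz⟩ := h.exists_mem_big_adj
    exact hy z hz hyz

theorem card_exclusive_le_one (hb : G.degree b = t + 2) : #(exclusive G t b) ≤ 1 := by
  refine card_le_one.2 fun x hx y hy => ?_
  by_contra hne
  have hbb : b ∈ big G t := mem_big.2 (by omega)
  have hxb : G.Adj x b := ((mem_exclusive.1 hx).2 b hbb).2 rfl
  have hyb : G.Adj y b := ((mem_exclusive.1 hy).2 b hbb).2 rfl
  have hxy : G.Adj x y := by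
    by_contra hxy
    rcases hG.activates hne hxy with h | h
    · exact not_activates_of_exclusive hb hx hyb.symm h
    · exact not_activates_of_exclusive hb hy hxb.symm h
  obtain ⟨hxd, v, -, z, hxz, hz, hnadj⟩ := mem_mobile.1 (mem_exclusive.1 hx).1
  obtain rfl : z = b := ((mem_exclusive.1 hx).2 z (mem_big.2 hz)).1 hxz
  exact hnadj hxd hb y (.inr hxy) hyb.symm

theorem card_inert_le (hx : x ∈ inert G t) : #(inert G t) ≤ G.degree x + 1 := by
  classical
  rw [← card_erase_add_one hx]
  refine Nat.add_le_add_right (card_le_card fun y hy => ?_) 1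
  obtain ⟨hyx, hy⟩ := mem_erase.1 hy
  rw [mem_neighborFinset]
  by_contra hxy
  rcases hG.activates hyx.symm hxy with h | h
  · exact (mem_inert.1 hx).2 y h
  · exact (mem_inert.1 hy).2 x h

theorem weight_le (hb : b ∈ big G t) :
    2 + (#(mobileAt G t b) + #(exclusive G t b)) ≤
      (t + 4) * (G.degree b - (t + 1)) + if ∃ z ∈ big G t, G.Adj b z then 0 else 1 := by
  have hE := card_exclusive_le_card_mobileAt hb
  have hM : #(mobileAt G t b) + 1 ≤ G.degree b + if ∃ z ∈ big G t, G.Adj b z then 0 else 1 := by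
    split_ifs with h
    · obtain ⟨z, hz, hbz⟩ := h
      exact card_mobileAt_lt hz hbz
    · exact Nat.add_le_add_right card_mobileAt_le 1
  obtain ⟨j, hj⟩ := Nat.exists_eq_add_of_lt (mem_big.1 hb)
  have hsurplus : G.degree b - (t + 1) = j + 1 := by omega
  rw [hsurplus]
  rcases Nat.eq_zero_or_pos j with rfl | hj0
  · have := hG.card_exclusive_le_one hj
    omega
  · have hM' := card_mobileAt_le (G := G) (t := t) (b := b)
    refine le_add_right ?_
    nlinarith

theorem two_mul_card_le :
    2 * Fintype.card V ≤ (t + 4) * ∑ v, (G.degree v - (t + 1)) + (2 * t + 5) := by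
  classical
  have hinert : #(inert G t) ≤ t + 2 := by
    rcases (inert G t).eq_empty_or_nonempty with h | ⟨x, hx⟩
    · simp [h]
    · exact (hG.card_inert_le hx).trans (Nat.succ_le_succ (mem_inert.1 hx).1)
  have hisolated : ∑ b ∈ big G t, (if ∃ z ∈ big G t, G.Adj b z then 0 else 1) ≤ 1 := by
    rw [sum_ite, sum_const_zero, zero_add, sum_const, smul_eq_mul, mul_one]
    refine card_le_one.2 fun x hx y hy => ?_
    simp only [mem_filter, not_exists, not_and] at hx hy
    exact hG.eq_of_forall_big_not_adj hx.2 hy.2 hy.1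
  have hbig : ∑ b ∈ big G t, (G.degree b - (t + 1)) ≤ ∑ v, (G.degree v - (t + 1)) :=
    sum_le_sum_of_subset (subset_univ _)
  have hweight := sum_le_sum fun b hb => hG.weight_le hb
  simp only [sum_add_distrib, sum_const, smul_eq_mul, ← mul_sum] at hweight
  have := Nat.mul_le_mul_left (t + 4) hbig
  have := card_big_add_card_mobile_add_card_inert (G := G) (t := t)
  have hmobile := two_mul_card_mobile_le (G := G) (t := t)
  rw [sum_add_distrib] at hmobile
  omega

theorem four_mul_sum_deficit_le : 4 * ∑ v, ((t + 1) - G.degree v) ≤ (t + 2) ^ 2 := by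
  have hdeficit : ∑ v, ((t + 1) - G.degree v) ≤ #(inert G t) * (t + 2 - #(inert G t)) := by
    rw [← smul_eq_mul, ← sum_const, ← sum_subset (subset_univ (inert G t))]
    · refine sum_le_sum fun x hx => ?_
      have := hG.card_inert_le hx
      omega
    · intro x _ hx
      by_contra hpos
      refine hx (mem_inert.2 ⟨by omega, fun y h => ?_⟩)
      have := h.1
      omega
  generalize #(inert G t) = m at hdeficit
  rcases le_total m (t + 2) with hm | hm
  · obtain ⟨j, hj⟩ := Nat.exists_eq_add_of_le hm
    rw [hj, Nat.add_sub_cancel_left] at hdeficit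
    rw [hj]
    linarith [four_mul_le_sq_add m j]
  · rw [Nat.sub_eq_zero_of_le hm, mul_zero] at hdeficit
    omega

theorem le_card_edgeFinset :
    4 * (t + 4) * (t + 1) * Fintype.card V + 8 * Fintype.card V ≤
      8 * (t + 4) * #G.edgeFinset + (t + 4) * (t + 2) ^ 2 + 4 * (2 * t + 5) := by
  have hbalance : ∑ v, G.degree v + ∑ v, ((t + 1) - G.degree v) =
      (t + 1) * Fintype.card V + ∑ v, (G.degree v - (t + 1)) := by
    rw [mul_comm, ← smul_eq_mul, ← card_univ, ← sum_const, ← sum_add_distrib,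
      ← sum_add_distrib]
    exact sum_congr rfl fun v _ => by omega
  have hsurplus := hG.two_mul_card_le
  have hdeficit := hG.four_mul_sum_deficit_le
  rw [G.sum_degrees_eq_twice_card_edges] at hbalance
  nlinarith

end IsSaturated

end LowerBound

theorem caterpillar_ne_bot (t : ℕ) : caterpillar t ≠ ⊥ :=
  ne_bot_iff_exists_adj.2 ⟨.inl 0, .inl 1, by simp [caterpillar, pathGraph_adj]⟩

theorem le_sat_caterpillar (t n : ℕ) :
    4 * (t + 4) * (t + 1) * n + 8 * n ≤
      8 * (t + 4) * sat n (caterpillar t) + (t + 4) * (t + 2) ^ 2 + 4 * (2 * t + 5) := by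
  classical
  obtain ⟨G₀, hG₀⟩ := exists_isSaturated (V := Fin n) _ (caterpillar_ne_bot t)
  obtain ⟨G, hG, hcard⟩ : sat n (caterpillar t) ∈ {m : ℕ | ∃ G : SimpleGraph (Fin n),
      IsSaturated (caterpillar t) G ∧ G.edgeSet.ncard = m} := Nat.sInf_mem ⟨_, G₀, hG₀, rfl⟩
  rw [← hcard, ← G.coe_edgeFinset, Set.ncard_coe_finset]
  simpa only [Fintype.card_fin] using hG.le_card_edgeFinset

/-! ### Graphs whose saturations have few edges -/

section DoubleStar

variable {V : Type*} {G : SimpleGraph V} {t : ℕ} {c d v : V} {L M : Finset V}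

/-- `c` and `d` are adjacent and have disjoint sets `L` and `M` of at least `t + 2` further
neighbours each: almost a copy of `caterpillar t`, lacking the third internal vertex. -/
structure IsDoubleStar (G : SimpleGraph V) (t : ℕ) (c d : V) (L M : Finset V) : Prop where
  adj : G.Adj c d
  adj_left : ∀ v ∈ L, G.Adj c v ∧ v ≠ d
  adj_right : ∀ v ∈ M, G.Adj d v ∧ v ≠ c
  le_card_left : t + 2 ≤ #L
  le_card_right : t + 2 ≤ #M
  disjoint : Disjoint L M

namespace IsDoubleStar

theorem not_free_of_adj_left (h : IsDoubleStar G t c d L M) (hcv : G.Adj c v) (hvd : v ≠ d)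
    (hvM : v ∉ M) {A : Finset V} (hA : ∀ u ∈ A, G.Adj v u ∧ u ≠ c ∧ u ≠ d) (hcard : t + 1 ≤ #A)
    (hinter : ∃ y, ∀ u ∈ A, u ≠ y → u ∉ L ∧ u ∉ M) : ¬ (caterpillar t).Free G := by
  classical
  -- `L` and `M` have vertices to spare, so they can give up the one they may share with `A`.
  obtain ⟨y, hy⟩ := hinter
  have hL : t ≤ #((L.erase v).erase y) := by
    have := L.pred_card_le_card_erase (a := v)
    have := (L.erase v).pred_card_le_card_erase (a := y)
    have := h.le_card_left
    omega
  have hM : t + 1 ≤ #(M.erase y) := by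
    have := M.pred_card_le_card_erase (a := y)
    have := h.le_card_right
    omega
  refine IsCaterpillar.not_free (a := v) (b := c) (c := d) (A := A) (B := (L.erase v).erase y)
    (C := M.erase y) ⟨hcv.symm, h.adj, hvd, hA, ?_, ?_, hcard, hL, hM, ?_, ?_, ?_⟩
  · have := h.adj_left
    grind
  · have := h.adj_right
    grind
  · grind [Finset.disjoint_left]
  · grind [Finset.disjoint_left]
  · exact h.disjoint.mono ((erase_subset _ _).trans (erase_subset _ _)) (erase_subset _ _)

theorem not_free_of_adj_both (h : IsDoubleStar G t c d L M) (hcv : G.Adj c v) (hdv : G.Adj d v)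
    {B : Finset V} (hB : ∀ u ∈ B, G.Adj v u ∧ u ≠ c ∧ u ≠ d) (hcard : t ≤ #B)
    (hBL : Disjoint L B) (hBM : Disjoint B M) : ¬ (caterpillar t).Free G := by
  classical
  have hL : t + 1 ≤ #(L.erase v) := by
    have := L.pred_card_le_card_erase (a := v)
    have := h.le_card_left
    omega
  have hM : t + 1 ≤ #(M.erase v) := by
    have := M.pred_card_le_card_erase (a := v)
    have := h.le_card_right
    omega
  refine IsCaterpillar.not_free (a := c) (b := v) (c := d) (A := L.erase v) (B := B)
    (C := M.erase v) ⟨hcv, hdv.symm, h.adj.ne, ?_, hB, ?_, hL, hcard, hM,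
      hBL.mono_left (erase_subset _ _), h.disjoint.mono (erase_subset _ _) (erase_subset _ _),
      hBM.mono_right (erase_subset _ _)⟩
  · have := h.adj_left
    grind
  · have := h.adj_right
    grind

end IsDoubleStar

end DoubleStar

section EdgeCount

variable {V : Type*} [Fintype V] {B G : SimpleGraph V} [DecidableRel B.Adj] [DecidableRel G.Adj]

theorem card_edgeFinset_le_add_sum_degree_sub (hle : B ≤ G) {P : Finset V}
    (hP : ∀ u v, G.Adj u v → ¬ B.Adj u v → u ∈ P ∨ v ∈ P) :
    #G.edgeFinset ≤ #B.edgeFinset + ∑ w ∈ P, (G.degree w - B.degree w) := by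
  classical
  have hcover : G.edgeFinset ⊆
      B.edgeFinset ∪ P.biUnion fun w => G.incidenceFinset w \ B.incidenceFinset w := by
    intro e he
    induction e with
    | _ u v =>
      simp only [mem_union, mem_edgeFinset, mem_edgeSet, mem_biUnion, mem_sdiff,
        mem_incidenceFinset, mk'_mem_incidenceSet_iff] at he ⊢
      grind
  refine (card_le_card hcover).trans ((card_union_le _ _).trans (Nat.add_le_add_left ?_ _))
  refine card_biUnion_le.trans (sum_le_sum fun w _ => ?_)
  have hsub : B.incidenceFinset w ⊆ G.incidenceFinset w := fun e he => by
    simp only [mem_incidenceFinset] at he ⊢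
    exact ⟨edgeSet_subset_edgeSet.2 hle he.1, he.2⟩
  rw [card_sdiff_of_subset hsub, card_incidenceFinset_eq_degree, card_incidenceFinset_eq_degree]

end EdgeCount

section Maximal

theorem exists_isSaturated_ge {W V : Type*} [Finite V] {H : SimpleGraph W} {G₀ : SimpleGraph V}
    (hfree : H.Free G₀) : ∃ G, G₀ ≤ G ∧ IsSaturated H G := by
  obtain ⟨G, hle, hG⟩ := (Set.toFinite {G : SimpleGraph V | H.Free G}).exists_le_maximal hfree
  refine ⟨G, hle, hG.prop, fun x y hxy hadj hfree' => hadj ?_⟩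
  exact hG.le_of_ge hfree' le_sup_left (sup_edge_adj_left hxy |>.2 (.inl rfl))

theorem sat_le_of_forall_ge {W V : Type*} [Fintype V] {H : SimpleGraph W} {G₀ : SimpleGraph V}
    {m : ℕ} (hfree : H.Free G₀) (hm : ∀ G, G₀ ≤ G → H.Free G → G.edgeSet.ncard ≤ m) :
    sat (Fintype.card V) H ≤ m := by
  let e := Fintype.equivFin V
  obtain ⟨G, hle, hG⟩ := exists_isSaturated_ge (G₀ := G₀.map e.toEmbedding)
    ((free_congr_right (Iso.map e G₀)).1 hfree)
  have iso : G.comap e ≃g G := Iso.comap e G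
  have hcomap : (G.comap e).edgeSet.ncard ≤ m :=
    hm _ (map_le_iff_le_comap _ _ _ |>.1 hle) ((free_congr_right iso).2 hG.1)
  have hcard : G.edgeSet.ncard = (G.comap e).edgeSet.ncard :=
    (Nat.card_congr iso.mapEdgeSet).symm
  have hsat : sat (Fintype.card V) H ≤ (G.comap e).edgeSet.ncard := Nat.sInf_le ⟨G, hG, hcard⟩
  exact hsat.trans hcomap

end Maximal

section Scaffold

/-- The combinatorial data behind the extremal graphs: centers `K`, matched in pairs by `partner`,
and leaves `X`, each attached to the center `hub x` and joined to the `t` leaves in `link x`. The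
leaves around a center are not linked to each other, nor to the leaves around its partner. -/
structure Scaffold (K X : Type*) [DecidableEq K] [Fintype X] (t : ℕ) where
  partner : K → K
  hub : X → K
  link : X → Finset X
  partner_partner : ∀ c, partner (partner c) = c
  partner_ne : ∀ c, partner c ≠ c
  link_symm : ∀ x, ∀ y ∈ link x, x ∈ link y
  card_link : ∀ x, #(link x) = t
  hub_ne : ∀ x, ∀ y ∈ link x, hub y ≠ hub x
  hub_ne_partner : ∀ x, ∀ y ∈ link x, hub y ≠ partner (hub x)
  le_card_hub : ∀ c, t + 2 ≤ #{x | hub x = c}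

/-- The vertices of the graphs built on a `Scaffold K X t`: besides centers and leaves, there are
the vertices `Q` of a clique and pendant vertices `W`. -/
inductive Vertex (K X Q W : Type*)
  | center (c : K)
  | leaf (x : X)
  | clique (i : Q)
  | pendant (w : W)
  deriving DecidableEq

variable {K X Q W : Type*}

namespace Vertex

theorem leaf_injective : Function.Injective (leaf : X → Vertex K X Q W) := fun _ _ => leaf.inj

theorem clique_injective : Function.Injective (clique : Q → Vertex K X Q W) :=
  fun _ _ => clique.inj

theorem pendant_injective : Function.Injective (pendant : W → Vertex K X Q W) :=
  fun _ _ => pendant.inj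

/-- The vertex set as a disjoint union of its four parts. -/
def equivSum : K ⊕ X ⊕ Q ⊕ W ≃ Vertex K X Q W where
  toFun := Sum.elim center (Sum.elim leaf (Sum.elim clique pendant))
  invFun
    | center c => .inl c
    | leaf x => .inr (.inl x)
    | clique i => .inr (.inr (.inl i))
    | pendant w => .inr (.inr (.inr w))
  left_inv := by rintro (_ | _ | _ | _) <;> rfl
  right_inv := by rintro (_ | _ | _ | _) <;> rfl

variable [Fintype K] [Fintype X] [Fintype Q] [Fintype W]

instance : Fintype (Vertex K X Q W) := Fintype.ofEquiv _ equivSum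

theorem card_eq : Fintype.card (Vertex K X Q W) =
    Fintype.card K + Fintype.card X + Fintype.card Q + Fintype.card W := by
  simp [← Fintype.card_congr (equivSum (K := K) (X := X) (Q := Q) (W := W)), add_assoc]

theorem sum_eq (f : Vertex K X Q W → ℕ) : ∑ v, f v =
    ∑ c, f (center c) + ∑ x, f (leaf x) + ∑ i, f (clique i) + ∑ w, f (pendant w) := by
  simp [← equivSum.sum_comp f, Fintype.sum_sum_type, equivSum, add_assoc]

end Vertex

namespace Scaffold

variable [DecidableEq K] [Fintype X] {t : ℕ} (S : Scaffold K X t)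

/-- The extremal graph on a scaffold: each center is joined to its partner and its leaves, each
leaf to its `t` links, the vertices `Q` form a clique, and all pendant vertices hang from `c₀`. -/
def graph (Q W : Type*) (c₀ : K) : SimpleGraph (Vertex K X Q W) where
  Adj
    | .center c, .center d => S.partner c = d
    | .center c, .leaf x | .leaf x, .center c => S.hub x = c
    | .leaf x, .leaf y => y ∈ S.link x
    | .clique i, .clique j => i ≠ j
    | .center c, .pendant _ | .pendant _, .center c => c = c₀
    | _, _ => False
  symm := ⟨by
    rintro (c | x | i | w) (d | y | j | w') h
    case center.center => exact h ▸ S.partner_partner c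
    case leaf.leaf => exact S.link_symm x y h
    case clique.clique => exact Ne.symm h
    all_goals exact h⟩
  loopless := ⟨by
    rintro (c | x | i | w) h
    · exact S.partner_ne c h
    · exact S.hub_ne x x h rfl
    · exact h rfl
    · exact h⟩

/-- The leaves around a center. -/
def leaves (Q W : Type*) (c : K) : Finset (Vertex K X Q W) :=
  ({x | S.hub x = c} : Finset X).map ⟨.leaf, Vertex.leaf_injective⟩

/-- The leaves linked to a leaf. -/
def links (Q W : Type*) (x : X) : Finset (Vertex K X Q W) :=
  (S.link x).map ⟨.leaf, Vertex.leaf_injective⟩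

variable {S} {c₀ : K} {G : SimpleGraph (Vertex K X Q W)}

theorem mem_leaves {c : K} {v : Vertex K X Q W} :
    v ∈ S.leaves Q W c ↔ ∃ x, S.hub x = c ∧ .leaf x = v := by
  simp [leaves]

theorem card_leaves (c : K) : #(S.leaves Q W c) = #{x | S.hub x = c} := card_map _

theorem disjoint_leaves {c d : K} (h : c ≠ d) : Disjoint (S.leaves Q W c) (S.leaves Q W d) := by
  simp only [Finset.disjoint_left, mem_leaves]
  grind

theorem mem_links {x : X} {v : Vertex K X Q W} :
    v ∈ S.links Q W x ↔ ∃ y ∈ S.link x, .leaf y = v := by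
  simp [links]

theorem card_links (x : X) : #(S.links Q W x) = t := (card_map _).trans (S.card_link x)

theorem disjoint_links_leaves_hub (x : X) :
    Disjoint (S.links Q W x) (S.leaves Q W (S.hub x)) := by
  have := S.hub_ne x
  simp only [Finset.disjoint_left, mem_links, mem_leaves]
  grind

theorem disjoint_links_leaves_partner (x : X) :
    Disjoint (S.links Q W x) (S.leaves Q W (S.partner (S.hub x))) := by
  have := S.hub_ne_partner x
  simp only [Finset.disjoint_left, mem_links, mem_leaves]
  grind

theorem adj_and_ne_center_of_mem_links (hle : S.graph Q W c₀ ≤ G) (x : X) :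
    ∀ v ∈ S.links Q W x, G.Adj (.leaf x) v ∧ ∀ c, v ≠ .center c := by
  intro v hv
  obtain ⟨y, hy, rfl⟩ := mem_links.1 hv
  exact ⟨hle hy, nofun⟩

theorem adj_and_ne_center_of_mem_leaves (hle : S.graph Q W c₀ ≤ G) (c : K) :
    ∀ v ∈ S.leaves Q W c, G.Adj (.center c) v ∧ ∀ d, v ≠ .center d := by
  intro v hv
  obtain ⟨x, hx, rfl⟩ := mem_leaves.1 hv
  exact ⟨hle hx, nofun⟩

theorem adj_center_partner (c : K) :
    (S.graph Q W c₀).Adj (.center c) (.center (S.partner c)) := rfl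

theorem adj_hub_leaf (x : X) : (S.graph Q W c₀).Adj (.center (S.hub x)) (.leaf x) := rfl

theorem adj_center_pendant (w : W) : (S.graph Q W c₀).Adj (.center c₀) (.pendant w) := rfl

theorem isDoubleStar (hle : S.graph Q W c₀ ≤ G) (c : K) :
    IsDoubleStar G t (.center c) (.center (S.partner c)) (S.leaves Q W c)
      (S.leaves Q W (S.partner c)) where
  adj := hle (adj_center_partner c)
  adj_left v hv := (adj_and_ne_center_of_mem_leaves hle c v hv).imp_right fun h => h _
  adj_right v hv := (adj_and_ne_center_of_mem_leaves hle _ v hv).imp_right fun h => h _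
  le_card_left := (S.le_card_hub c).trans_eq (card_leaves c).symm
  le_card_right := (S.le_card_hub _).trans_eq (card_leaves _).symm
  disjoint := disjoint_leaves (S.partner_ne c).symm

theorem not_adj_leaf_partner (hle : S.graph Q W c₀ ≤ G) (hfree : (caterpillar t).Free G) (x : X) :
    ¬ G.Adj (.leaf x) (.center (S.partner (S.hub x))) := fun h =>
  (isDoubleStar hle (S.hub x)).not_free_of_adj_both (B := S.links Q W x)
    (hle (adj_hub_leaf x)) h.symm
    (fun v hv => (adj_and_ne_center_of_mem_links hle x v hv).imp_right fun h => ⟨h _, h _⟩)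
    (card_links x).ge (disjoint_links_leaves_hub x).symm (disjoint_links_leaves_partner x) hfree

theorem graph_adj_of_leaf_adj (hle : S.graph Q W c₀ ≤ G) (hfree : (caterpillar t).Free G) {x : X}
    {v : Vertex K X Q W} (h : G.Adj (.leaf x) v) : (S.graph Q W c₀).Adj (.leaf x) v := by
  classical
  by_contra hv
  have hhub : v ≠ .center (S.hub x) := by
    rintro rfl
    exact hv rfl
  have hpartner : v ≠ .center (S.partner (S.hub x)) := by
    rintro rfl
    exact not_adj_leaf_partner hle hfree x h
  have hlinks : v ∉ S.links Q W x := fun hmem =>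
    hv (adj_and_ne_center_of_mem_links le_rfl x v hmem).1
  refine (isDoubleStar hle (S.hub x)).not_free_of_adj_left
    (A := insert v (S.links Q W x)) (hle (adj_hub_leaf x)) nofun ?_ ?_ ?_
    ⟨v, ?_⟩ hfree
  · simpa [mem_leaves] using (S.partner_ne (S.hub x)).symm
  · exact Finset.forall_mem_insert _ _ _ |>.2 ⟨⟨h, hhub, hpartner⟩, fun u hu =>
      (adj_and_ne_center_of_mem_links hle x u hu).imp_right fun h => ⟨h _, h _⟩⟩
  · rw [card_insert_of_notMem hlinks, card_links]
  · intro u hu huv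
    have hu' := (mem_insert.1 hu).resolve_left huv
    exact ⟨Finset.disjoint_left.1 (disjoint_links_leaves_hub x) hu',
      Finset.disjoint_left.1 (disjoint_links_leaves_partner x) hu'⟩

theorem partner_eq_of_adj (hle : S.graph Q W c₀ ≤ G) (hfree : (caterpillar t).Free G) {c d : K}
    (h : G.Adj (.center c) (.center d)) : S.partner c = d := by
  by_contra hne
  have hcd : c ≠ d := by
    rintro rfl
    exact G.irrefl h
  refine (isDoubleStar hle c).not_free_of_adj_left (A := S.leaves Q W d) h ?_ ?_ ?_ ?_
    ⟨.center d, fun u hu _ => ?_⟩ hfree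
  · simpa using Ne.symm hne
  · simp [mem_leaves]
  · exact fun v hv => (adj_and_ne_center_of_mem_leaves hle d v hv).imp_right fun h => ⟨h _, h _⟩
  · exact (Nat.le_succ _).trans ((S.le_card_hub d).trans_eq (card_leaves d).symm)
  · exact ⟨Finset.disjoint_right.1 (disjoint_leaves hcd) hu,
      Finset.disjoint_right.1 (disjoint_leaves hne) hu⟩

theorem not_adj_center_clique [Fintype Q] (hQ : Nonempty Q → Fintype.card Q = t + 2)
    (hle : S.graph Q W c₀ ≤ G) (hfree : (caterpillar t).Free G) (c : K) (i : Q) :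
    ¬ G.Adj (.center c) (.clique i) := by
  classical
  intro h
  refine (isDoubleStar hle c).not_free_of_adj_left
    (A := ({i}ᶜ : Finset Q).map ⟨.clique, Vertex.clique_injective⟩)
    h nofun ?_ ?_ ?_ ⟨.clique i, ?_⟩ hfree
  · simp [mem_leaves]
  · exact Finset.forall_mem_map.2 fun j hj =>
      ⟨hle (show i ≠ j by simpa [eq_comm] using hj), nofun, nofun⟩
  · rw [card_map, card_compl, card_singleton, hQ ⟨i⟩]
    rfl
  · exact Finset.forall_mem_map.2 fun j _ _ => by simp [mem_leaves]

theorem exists_pendant_of_adj_of_not_graph_adj [Fintype Q]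
    (hQ : Nonempty Q → Fintype.card Q = t + 2) (hle : S.graph Q W c₀ ≤ G)
    (hfree : (caterpillar t).Free G) {u v : Vertex K X Q W}
    (h : G.Adj u v) (hn : ¬ (S.graph Q W c₀).Adj u v) : ∃ w, .pendant w = u ∨ .pendant w = v := by
  rcases u with c | x | i | w
  case leaf => exact absurd (graph_adj_of_leaf_adj hle hfree h) hn
  case pendant => exact ⟨w, .inl rfl⟩
  all_goals rcases v with d | y | j | w
  case center.pendant | clique.pendant => exact ⟨w, .inr rfl⟩
  case center.leaf | clique.leaf =>
    exact absurd (graph_adj_of_leaf_adj hle hfree h.symm).symm hn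
  case center.center => exact absurd (partner_eq_of_adj hle hfree h) hn
  case center.clique => exact absurd h (not_adj_center_clique hQ hle hfree c j)
  case clique.center => exact absurd h.symm (not_adj_center_clique hQ hle hfree d i)
  case clique.clique => exact absurd (fun hij => h.ne (congrArg _ hij)) hn

theorem degree_pendant_le [Fintype K] [Fintype Q] [Fintype W] [DecidableRel G.Adj]
    (hle : S.graph Q W c₀ ≤ G) (hfree : (caterpillar t).Free G) (w : W) :
    G.degree (.pendant w) ≤ t + 1 := by
  classical
  by_contra! hdeg
  have hnotMem (c : K) : ∀ v, G.Adj (.pendant w) v → v ∉ S.leaves Q W c := by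
    intro v hv hmem
    obtain ⟨x, -, rfl⟩ := mem_leaves.1 hmem
    exact graph_adj_of_leaf_adj hle hfree hv.symm
  have hadj : G.Adj (.center c₀) (.pendant w) := hle (adj_center_pendant w)
  have hD := isDoubleStar hle c₀
  set A := (G.neighborFinset (.pendant w)).erase (.center c₀)
  have hA (v) (hv : v ∈ A) : v ≠ .center c₀ ∧ G.Adj (.pendant w) v := by simpa [A] using hv
  have hAcard : t + 1 ≤ #A := by
    rw [card_erase_of_mem (by simpa using hadj.symm), card_neighborFinset_eq_degree]
    omega
  by_cases hp : G.Adj (.center (S.partner c₀)) (.pendant w)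
  · refine hD.not_free_of_adj_both (B := A.erase (.center (S.partner c₀))) hadj hp ?_ ?_ ?_ ?_ hfree
    · intro v hv
      obtain ⟨hvp, hv⟩ := mem_erase.1 hv
      exact ⟨(hA v hv).2, (hA v hv).1, hvp⟩
    · have := A.pred_card_le_card_erase (a := .center (S.partner c₀))
      omega
    · exact Finset.disjoint_right.2 fun v hv => hnotMem _ v (hA v (mem_of_mem_erase hv)).2
    · exact Finset.disjoint_left.2 fun v hv => hnotMem _ v (hA v (mem_of_mem_erase hv)).2
  · refine hD.not_free_of_adj_left (A := A) hadj nofun ?_ ?_ hAcard ⟨.center c₀, ?_⟩ hfree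
    · simp [mem_leaves]
    · rintro v hv
      refine ⟨(hA v hv).2, (hA v hv).1, ?_⟩
      rintro rfl
      exact hp (hA _ hv).2.symm
    · exact fun v hv _ => ⟨hnotMem _ v (hA v hv).2, hnotMem _ v (hA v hv).2⟩

section Degree

variable [Fintype K] [Fintype Q] [Fintype W] [DecidableRel (S.graph Q W c₀).Adj]

theorem degree_graph (v : Vertex K X Q W) : (S.graph Q W c₀).degree v =
    {c | (S.graph Q W c₀).Adj v (.center c)}.ncard + {x | (S.graph Q W c₀).Adj v (.leaf x)}.ncard +
      {i | (S.graph Q W c₀).Adj v (.clique i)}.ncard +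
      {w | (S.graph Q W c₀).Adj v (.pendant w)}.ncard := by
  simp only [← card_neighborFinset_eq_degree, neighborFinset_eq_filter, card_filter,
    Vertex.sum_eq, Set.ncard_eq_toFinset_card', Set.toFinset_ofPred]

theorem degree_center (c : K) : (S.graph Q W c₀).degree (.center c) =
    1 + #{x | S.hub x = c} + if c = c₀ then Fintype.card W else 0 := by
  rw [degree_graph]
  split_ifs with h <;> simp [graph, h, Set.ncard_eq_toFinset_card']

theorem degree_leaf (x : X) : (S.graph Q W c₀).degree (.leaf x) = t + 1 := by
  rw [degree_graph]
  simp [graph, S.card_link, add_comm]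

theorem degree_clique (i : Q) : (S.graph Q W c₀).degree (.clique i) = Fintype.card Q - 1 := by
  classical
  rw [degree_graph]
  simp [graph, Set.ncard_eq_toFinset_card', Finset.filter_ne]

theorem degree_pendant (w : W) : (S.graph Q W c₀).degree (.pendant w) = 1 := by
  rw [degree_graph]
  simp [graph]

end Degree

section EdgeCount

variable {K X Q W : Type*} [DecidableEq K] [Fintype K] [Fintype X] [Fintype Q] [Fintype W] {t : ℕ}
  {S : Scaffold K X t} {c₀ : K} {G : SimpleGraph (Vertex K X Q W)}

theorem eq_center_of_le_degree [DecidableRel (S.graph Q W c₀).Adj]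
    (hQ : Nonempty Q → Fintype.card Q = t + 2) {v : Vertex K X Q W}
    (hv : t + 2 ≤ (S.graph Q W c₀).degree v) : ∃ c, v = .center c := by
  cases v with
  | center c => exact ⟨c, rfl⟩
  | leaf x =>
    rw [degree_leaf] at hv
    omega
  | clique i =>
    rw [degree_clique, hQ ⟨i⟩] at hv
    omega
  | pendant w =>
    rw [degree_pendant] at hv
    omega

omit [Fintype K] [Fintype W] in
theorem graph_free [Finite K] [Finite W] (hQ : Nonempty Q → Fintype.card Q = t + 2) :
    (caterpillar t).Free (S.graph Q W c₀) := by
  classical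
  cases nonempty_fintype K
  cases nonempty_fintype W
  intro h
  obtain ⟨u, v, w, hne, huv, hvw⟩ := exists_isSpineEdge_of_not_free fun hfree => hfree h
  obtain ⟨a, rfl⟩ := eq_center_of_le_degree hQ huv.le_degree_left
  obtain ⟨b, rfl⟩ := eq_center_of_le_degree hQ hvw.le_degree_left
  obtain ⟨c, rfl⟩ := eq_center_of_le_degree hQ hvw.le_degree_right
  have hba : S.partner b = a := huv.adj.symm
  have hbc : S.partner b = c := hvw.adj
  exact hne (congrArg _ (hba.symm.trans hbc))

theorem two_mul_card_edgeFinset_graph [DecidableRel (S.graph Q W c₀).Adj]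
    (hQ : Nonempty Q → Fintype.card Q = t + 2) :
    2 * #(S.graph Q W c₀).edgeFinset = Fintype.card K + (t + 2) * Fintype.card X +
      (t + 1) * Fintype.card Q + 2 * Fintype.card W := by
  have hfiber : ∑ c, #{x | S.hub x = c} = Fintype.card X :=
    (card_eq_sum_card_fiberwise fun x _ => mem_univ (S.hub x)).symm
  have hclique : Fintype.card Q * (Fintype.card Q - 1) = Fintype.card Q * (t + 1) := by
    rcases isEmpty_or_nonempty Q with _ | h
    · simp
    · rw [hQ h, Nat.add_succ_sub_one]
  rw [← sum_degrees_eq_twice_card_edges, Vertex.sum_eq]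
  simp only [degree_center, degree_leaf, degree_clique, degree_pendant, sum_add_distrib, hfiber,
    sum_ite_eq', sum_const, smul_eq_mul, card_univ, mem_univ, if_true, hclique]
  ring

theorem two_mul_card_edgeFinset_le [DecidableRel G.Adj]
    (hQ : Nonempty Q → Fintype.card Q = t + 2)
    (hle : S.graph Q W c₀ ≤ G) (hfree : (caterpillar t).Free G) :
    2 * #G.edgeFinset ≤ Fintype.card K + (t + 2) * Fintype.card X + (t + 1) * Fintype.card Q +
      2 * (t + 1) * Fintype.card W := by
  classical
  have hnew := card_edgeFinset_le_add_sum_degree_sub hle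
    (P := univ.map ⟨.pendant, Vertex.pendant_injective⟩) fun u v h hn => by
      obtain ⟨w, rfl | rfl⟩ := exists_pendant_of_adj_of_not_graph_adj hQ hle hfree h hn <;> simp
  have hsum : ∑ w, (G.degree (.pendant w) - (S.graph Q W c₀).degree (.pendant w)) ≤
      Fintype.card W * t := by
    refine sum_le_card_nsmul univ _ t fun w _ => ?_
    have := degree_pendant_le hle hfree w
    rw [degree_pendant]
    omega
  rw [sum_map] at hnew
  have hbase := two_mul_card_edgeFinset_graph (S := S) (c₀ := c₀) (W := W) hQ
  linarith [hnew.trans (Nat.add_le_add_left hsum _)]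

theorem two_mul_sat_le (S : Scaffold K X t) (c₀ : K) (hQ : Nonempty Q → Fintype.card Q = t + 2) :
    2 * sat (Fintype.card (Vertex K X Q W)) (caterpillar t) ≤ Fintype.card K +
      (t + 2) * Fintype.card X + (t + 1) * Fintype.card Q + 2 * (t + 1) * Fintype.card W := by
  classical
  refine (Nat.mul_le_mul_left 2 (sat_le_of_forall_ge (graph_free (S := S) (c₀ := c₀) hQ)
    fun G hle hfree => ?_)).trans (Nat.mul_div_le _ 2)
  rw [Nat.le_div_iff_mul_le two_pos, mul_comm, ← coe_edgeFinset, Set.ncard_coe_finset]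
  exact two_mul_card_edgeFinset_le hQ hle hfree

end EdgeCount

end Scaffold

end Scaffold
section Blocks

variable {ι : Type*} [Fintype ι] [DecidableEq ι] {L : ι → Type*} [∀ i, AddGroup (L i)]
  [∀ i, Fintype (L i)] [∀ i, DecidableEq (L i)] {t : ℕ}

/-- The scaffold made of blocks indexed by `ι`. Block `i` has two centers, each with leaves indexed
by the group `L i`, and its leaves `p` and `q` on the two sides are linked when `-p + q ∈ D i`. The
permutation `σ` matches the first center of block `i` with the second center of block `σ i`. -/
def blockScaffold (σ : Equiv.Perm ι) (hσ : ∀ i, σ i ≠ i) (D : ∀ i, Finset (L i))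
    (hD : ∀ i, #(D i) = t) (hL : ∀ i, t + 2 ≤ Fintype.card (L i)) :
    Scaffold (ι × Bool) (Σ i, L i × Bool) t where
  partner
    | (i, false) => (σ i, true)
    | (i, true) => (σ.symm i, false)
  hub x := (x.1, x.2.2)
  link
    | ⟨i, p, false⟩ => (D i).image fun d => ⟨i, p + d, true⟩
    | ⟨i, q, true⟩ => (D i).image fun d => ⟨i, q - d, false⟩
  partner_partner := by
    rintro ⟨i, _ | _⟩ <;> simp
  partner_ne := by
    rintro ⟨i, _ | _⟩ <;> simp
  link_symm := by
    rintro ⟨i, p, _ | _⟩ y hy <;> obtain ⟨d, hd, rfl⟩ := mem_image.1 hy <;>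
      exact mem_image.2 ⟨d, hd, by simp⟩
  card_link := by
    rintro ⟨i, p, _ | _⟩ <;> refine (card_image_of_injective _ fun d d' h => ?_).trans (hD i) <;>
      simpa using h
  hub_ne := by
    rintro ⟨i, p, _ | _⟩ y hy <;> obtain ⟨d, -, rfl⟩ := mem_image.1 hy <;> simp
  hub_ne_partner := by
    rintro ⟨i, p, _ | _⟩ y hy <;> obtain ⟨d, -, rfl⟩ := mem_image.1 hy
    · simpa using (hσ i).symm
    · simpa [Equiv.eq_symm_apply] using hσ i
  le_card_hub := by
    rintro ⟨i, b⟩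
    refine (hL i).trans (card_le_card_of_injOn (fun p => ⟨i, p, b⟩) (by simp [Set.MapsTo]) ?_)
    intro p _ q _ h
    simpa using h

theorem two_mul_sat_caterpillar_le_of_blocks {k : ℕ} (hk : 2 ≤ k) (t e ω : ℕ) {κ : ℕ}
    (hκ : κ = 0 ∨ κ = t + 2) :
    2 * sat (2 * k + 2 * (k * (t + 2) + e) + κ + ω) (caterpillar t) ≤
      2 * k + (t + 2) * (2 * (k * (t + 2) + e)) + (t + 1) * κ + 2 * (t + 1) * ω := by
  obtain ⟨m, rfl⟩ := Nat.exists_eq_add_of_le' hk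
  let size (i : Fin (m + 2)) : ℕ := Pi.single (M := fun _ => ℕ) 0 e i + (t + 2)
  have hD (i) : ∃ D : Finset (Fin (size i)), #D = t :=
    (exists_subset_card_eq (s := univ) (n := t) (by simp [size]; omega)).imp fun _ h => h.2
  choose D hD using hD
  have hσ (i : Fin (m + 2)) : Equiv.addRight 1 i ≠ i := by simp
  have hQ : Nonempty (Fin κ) → Fintype.card (Fin κ) = t + 2 := by
    rintro ⟨i⟩
    have := i.pos
    rw [Fintype.card_fin]
    omega
  have hX : Fintype.card (Σ i, Fin (size i) × Bool) = ((m + 2) * (t + 2) + e) * 2 := by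
    simp [size, ← sum_mul, sum_add_distrib, add_comm]
  have h := Scaffold.two_mul_sat_le (W := Fin ω)
    (blockScaffold (Equiv.addRight 1) hσ D hD fun i => by simp [size]) (0, false) hQ
  rw [Vertex.card_eq, hX] at h
  simpa [mul_comm _ 2] using h

/-- The last inequality says that the `2 * e` additional leaves and the `ω` pendant vertices do not
raise the number of edges too far above the intended density. -/
theorem exists_block_decomposition {t n : ℕ} (hn : 2 * (2 * t + 6) ≤ n) :
    ∃ k e κ ω, 2 ≤ k ∧ (κ = 0 ∨ κ = t + 2) ∧ n = 2 * k + 2 * (k * (t + 2) + e) + κ + ω ∧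
      2 * (t + 1) * e + (t ^ 2 + 4 * t + 1) * ω ≤ 2 * κ + 2 * (t + 1) * (t + 2) := by
  set k := n / (2 * t + 6)
  set r := n % (2 * t + 6)
  have hk : 2 ≤ k := (Nat.le_div_iff_mul_le (by omega)).2 hn
  have hr : r < 2 * t + 6 := Nat.mod_lt _ (by omega)
  have hdiv : (2 * t + 6) * k + r = n := Nat.div_add_mod n _
  obtain ⟨κ, hκr, hκ⟩ : ∃ κ ≤ r, κ = 0 ∧ r ≤ t + 1 ∨ κ = t + 2 ∧ r - κ ≤ t + 3 := by
    rcases le_or_gt r (t + 1) with h | h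
    · exact ⟨0, by omega⟩
    · exact ⟨t + 2, by omega⟩
  have hsplit : 2 * ((r - κ) / 2) + (r - κ) % 2 = r - κ := Nat.div_add_mod _ 2
  have hω : (r - κ) % 2 ≤ 1 := Nat.le_of_lt_succ (Nat.mod_lt _ two_pos)
  refine ⟨k, (r - κ) / 2, κ, (r - κ) % 2, hk, hκ.imp And.left And.left, ?_, ?_⟩
  · have : (2 * t + 6) * k = 2 * k + 2 * (k * (t + 2)) := by ring
    omega
  · generalize (r - κ) / 2 = e, (r - κ) % 2 = ω at hsplit hω ⊢
    have hω' := Nat.mul_le_mul_left (t ^ 2 + 3 * t) hω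
    rcases hκ with ⟨rfl, h⟩ | ⟨rfl, h⟩
    · have hle : 2 * e + ω ≤ t + 1 := by omega
      linarith [Nat.mul_le_mul_left (t + 1) hle]
    · have hle : 2 * e + ω ≤ t + 3 := by omega
      linarith [Nat.mul_le_mul_left (t + 1) hle]

theorem sat_caterpillar_le {t n : ℕ} (hn : 2 * (2 * t + 6) ≤ n) :
    2 * (t + 3) * sat n (caterpillar t) ≤ ((t + 1) * (t + 3) + 2) * n + 2 * (t + 1) * (t + 2) := by
  obtain ⟨k, e, κ, ω, hk, hκ, rfl, hslack⟩ := exists_block_decomposition hn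
  linarith [Nat.mul_le_mul_left (t + 3) (two_mul_sat_caterpillar_le_of_blocks hk t e ω hκ)]

end Blocks

end SaturationNumber

theorem mainTheorem5_general (s n : ℕ) (hs : 1 ≤ s) :
    ((s : ℝ) + 2 / ((s : ℝ) + 3)) * ((n : ℝ) / 2)
        - ((2 * (s : ℝ) + 3) / (2 * (s : ℝ) + 6) + ((s : ℝ) + 1) ^ 2 / 8)
      ≤ (SaturationNumber.sat n (SaturationNumber.caterpillar (s - 1)) : ℝ) ∧
    (2 * (2 * s + 4) ≤ n →
      (SaturationNumber.sat n (SaturationNumber.caterpillar (s - 1)) : ℝ)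
        ≤ ((s : ℝ) + 2 / ((s : ℝ) + 2)) * ((n : ℝ) / 2)
          + (s : ℝ) * ((s : ℝ) + 1) / ((s : ℝ) + 2)) := by
  obtain ⟨t, rfl⟩ := Nat.exists_eq_add_of_le' hs
  rw [Nat.add_sub_cancel]
  constructor
  · have h : (4 * (t + 4) * (t + 1) * n + 8 * n : ℝ) ≤
        8 * (t + 4) * SaturationNumber.sat n (SaturationNumber.caterpillar t) +
          (t + 4) * (t + 2) ^ 2 + 4 * (2 * t + 5) :=
      mod_cast SaturationNumber.le_sat_caterpillar t n
    calc _ = (4 * (t + 4) * (t + 1) * n + 8 * n - ((t + 4) * (t + 2) ^ 2 + 4 * (2 * t + 5)) : ℝ) /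
          (8 * (t + 4)) := by push_cast; field_simp; ring
      _ ≤ _ := (div_le_iff₀' (by positivity)).2 (by linarith)
  · intro hn
    have h : (2 * (t + 3) * SaturationNumber.sat n (SaturationNumber.caterpillar t) : ℝ) ≤
        ((t + 1) * (t + 3) + 2) * n + 2 * (t + 1) * (t + 2) :=
      mod_cast SaturationNumber.sat_caterpillar_le (by omega)
    push_cast
    field_simp
    linarith

theorem mainTheorem5 (s n : ℕ) (hs : 1 ≤ s)
    (hn : max 2 ((s - 1) / 2) * (2 * s + 4) + s + 1 ≤ n) :
    ((s : ℝ) + 2 / ((s : ℝ) + 3)) * ((n : ℝ) / 2)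
        - ((2 * (s : ℝ) + 3) / (2 * (s : ℝ) + 6) + ((s : ℝ) + 1) ^ 2 / 8)
      ≤ (SaturationNumber.sat n (SaturationNumber.caterpillar (s - 1)) : ℝ) ∧
    (SaturationNumber.sat n (SaturationNumber.caterpillar (s - 1)) : ℝ)
      ≤ ((s : ℝ) + 2 / ((s : ℝ) + 2)) * ((n : ℝ) / 2)
        + (s : ℝ) * ((s : ℝ) + 1) / ((s : ℝ) + 2) :=
  (mainTheorem5_general s n hs).imp_right fun h =>
    h (by linarith [Nat.mul_le_mul_right (2 * s + 4) (le_max_left 2 ((s - 1) / 2))])
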